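/- Let ${}_pF_q(a_1,\dots,a_p;b_1,\dots,b_q;z)=\sum_{n\ge 0}\frac{(a_1)_n\cdots(a_p)_n}{(b_1)_n\cdots(b_q)_n}\frac{z^n}{n!}$, where $(c)_n=c(c+1)\cdots(c+n-1)$ for $n\in\mathbb{N}$, and $(c)_g=\Gamma(c+g)/\Gamma(c)$ for complex index $g$. Let $k,\mu,\nu$ be any complex numbers such that $\mu$ and $\nu$ are not negative integers and $\mu+\nu$ is not an integer $\le 1$. Then $$ {}_2F_3\left(\tfrac12,\tfrac{\mu}{2}+\tfrac{\nu}{2}+1;\ \mu+1,\nu+1,\mu+\nu+1;\ -k^2\right) =\frac{2^{2(\mu+\nu)-3}(\mu+\nu-1)\,\Gamma(\mu+1)\,\Gamma(\nu+1)}{\pi\,\Gamma(\mu+\nu-1)}\sum_{L=0}^{\infty} t_L, $$ where the series on the right converges absolutely and $$ \begin{aligned} t_L={}&\frac{(-1)^{2L}k^{4L}\,2^{4L-2\mu-2\nu+2}\left(\left(\tfrac{\mu}{2}+\tfrac{\nu}{2}\right)_{2L}\right)^2\Gamma(2L+\mu+\nu-1)}{(2L)!\,\left(L+\tfrac12\right)_{\mu+\frac12}\left(L+\tfrac12\right)_{\nu+\frac12}\left(2L+\tfrac{\mu}{2}+\tfrac{\nu}{2}-\tfrac12\right)\left((\mu+\nu-1)_{2L}\right)^2\left((2L+\mu+\nu-1)_{2L}\right)^2}\\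 &\times{}_1F_2\left(L+\tfrac12;\ L+\mu+1,\,2L+\tfrac{\mu}{2}+\tfrac{\nu}{2}+\tfrac12;\ -\tfrac{k^2}{4}\right)\\ &\times{}_1F_2\left(L+\tfrac12;\ 2L+\tfrac{\mu}{2}+\tfrac{\nu}{2}+\tfrac12,\,L+\nu+1;\ -\tfrac{k^2}{4}\right). \end{aligned} $$ -/

import Mathlib

/-- The generalized hypergeometric function `pFq(a₁, …, a_p; b₁, …, b_q; z)`, as the sum of its
power series `∑ₙ (a₁)ₙ ⋯ (a_p)ₙ / ((b₁)ₙ ⋯ (b_q)ₙ) * zⁿ / n!`, where `(x)ₙ = x (x + 1) ⋯ (x + n - 1)`.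
The parameters are given as multisets (with repetitions). The series converges for every `z` when
`p ≤ q` and no `b_j` is a nonpositive integer. -/
noncomputable def hypergeometricPFQ (a b : Multiset ℂ) (z : ℂ) : ℂ :=
  ∑' n : ℕ, (a.map fun x => (ascPochhammer ℂ n).eval x).prod /
    (b.map fun x => (ascPochhammer ℂ n).eval x).prod * (z ^ n / (n.factorial : ℂ))

/-- The Pochhammer symbol with natural index, `(c)ₙ = c (c + 1) ⋯ (c + n - 1)`. -/
noncomputable def pochhammerNat (c : ℂ) (n : ℕ) : ℂ := (ascPochhammer ℂ n).eval c

/-- The Pochhammer symbol with complex index, `(c)_g = Γ(c + g) / Γ(c)`. -/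
noncomputable def pochhammerGamma (c g : ℂ) : ℂ := Complex.Gamma (c + g) / Complex.Gamma c

/-- The general term (index `L`) of the series of products of two `1F2` functions. -/
noncomputable def pairProductTerm (k μ ν : ℂ) (L : ℕ) : ℂ :=
  (-1) ^ (2 * L) * k ^ (4 * L) * (2 : ℂ) ^ (4 * (L : ℂ) - 2 * μ - 2 * ν + 2) *
      pochhammerNat (μ / 2 + ν / 2) (2 * L) ^ 2 * Complex.Gamma (2 * (L : ℂ) + μ + ν - 1) /
    (((2 * L).factorial : ℂ) *
      pochhammerGamma ((L : ℂ) + 1 / 2) (μ + 1 / 2) *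
      pochhammerGamma ((L : ℂ) + 1 / 2) (ν + 1 / 2) *
      (2 * (L : ℂ) + μ / 2 + ν / 2 - 1 / 2) *
      pochhammerNat (μ + ν - 1) (2 * L) ^ 2 *
      pochhammerNat (2 * (L : ℂ) + μ + ν - 1) (2 * L) ^ 2) *
  hypergeometricPFQ {(L : ℂ) + 1 / 2}
    {(L : ℂ) + μ + 1, 2 * (L : ℂ) + μ / 2 + ν / 2 + 1 / 2} (-k ^ 2 / 4) *
  hypergeometricPFQ {(L : ℂ) + 1 / 2}
    {2 * (L : ℂ) + μ / 2 + ν / 2 + 1 / 2, (L : ℂ) + ν + 1} (-k ^ 2 / 4)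

open Finset

lemma pochhammerNat_zero (c : ℂ) : pochhammerNat c 0 = 1 := by simp [pochhammerNat]

lemma pochhammerNat_succ (c : ℂ) (n : ℕ) :
    pochhammerNat c (n + 1) = pochhammerNat c n * (c + n) := by
  simp [pochhammerNat, ascPochhammer_succ_eval]

lemma pochhammerNat_add (c : ℂ) (n m : ℕ) :
    pochhammerNat c (n + m) = pochhammerNat c n * pochhammerNat (c + n) m := by
  induction m with
  | zero => simp [pochhammerNat_zero]
  | succ m ih =>
    rw [← add_assoc, pochhammerNat_succ, pochhammerNat_succ, ih]; push_cast; ring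

lemma pochhammerNat_ne_zero {c : ℂ} (hc : ∀ n : ℕ, c + n ≠ 0) (n : ℕ) :
    pochhammerNat c n ≠ 0 := by
  induction n with
  | zero => simp [pochhammerNat_zero]
  | succ n ih => rw [pochhammerNat_succ]; exact mul_ne_zero ih (hc n)

lemma pochhammerNat_two_mul (c : ℂ) (n : ℕ) :
    pochhammerNat (2 * c) (2 * n) = 4 ^ n * pochhammerNat c n * pochhammerNat (c + 1 / 2) n := by
  induction n with
  | zero => simp [pochhammerNat_zero]
  | succ n ih =>
    rw [show 2 * (n + 1) = 2 * n + 1 + 1 by ring]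
    simp only [pochhammerNat_succ, ih]; push_cast; ring

lemma factorial_two_mul_eq (n : ℕ) :
    ((2 * n).factorial : ℂ) = 4 ^ n * n.factorial * pochhammerNat (1 / 2) n := by
  induction n with
  | zero => simp [pochhammerNat_zero]
  | succ n ih =>
    rw [show 2 * (n + 1) = 2 * n + 1 + 1 by ring]
    simp only [Nat.factorial_succ, Nat.cast_mul, pochhammerNat_succ, ih]; push_cast; ring

lemma Gamma_add_natCast {c : ℂ} (hc : ∀ n : ℕ, c + n ≠ 0) (n : ℕ) :
    Complex.Gamma (c + n) = pochhammerNat c n * Complex.Gamma c := by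
  induction n with
  | zero => simp [pochhammerNat_zero]
  | succ n ih =>
    rw [pochhammerNat_succ, Nat.cast_succ, ← add_assoc, Complex.Gamma_add_one _ (hc n), ih]; ring

/-- The Chu-Vandermonde convolution for Pochhammer symbols. -/
lemma sum_antidiagonal_choose_mul_pochhammerNat (x y : ℂ) (N : ℕ) :
    ∑ p ∈ antidiagonal N, (N.choose p.1 : ℂ) * (pochhammerNat x p.1 * pochhammerNat y p.2) =
      pochhammerNat (x + y) N := by
  induction N with
  | zero => simp [pochhammerNat_zero]
  | succ N ih =>
    rw [Finset.sum_antidiagonal_choose_succ_mul (fun i j => pochhammerNat x i * pochhammerNat y j),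
      pochhammerNat_succ, ← ih, Finset.sum_mul, ← Finset.sum_add_distrib]
    refine Finset.sum_congr rfl fun p hp => ?_
    have hp : p.1 + p.2 = N := by simpa using hp
    rw [pochhammerNat_succ, pochhammerNat_succ, Nat.choose_symm_of_eq_add (by omega : N = p.2 + p.1),
      ← hp]
    push_cast
    ring

lemma pochhammerNat_reflect (c : ℂ) (n : ℕ) :
    pochhammerNat c n = (-1) ^ n * pochhammerNat (1 - c - n) n := by
  induction n generalizing c with
  | zero => simp [pochhammerNat_zero]
  | succ n ih =>
    rw [pochhammerNat_succ, ih, add_comm n 1, pochhammerNat_add _ 1 n, pochhammerNat_succ,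
      pochhammerNat_zero]
    push_cast
    rw [show (1 - c - (1 + (n : ℂ)) + 1) = 1 - c - n by ring]
    ring

/-- The coefficients of a product of two `0F1` functions. -/
lemma sum_antidiagonal_inv_pochhammerNat {x y : ℂ} (hx : ∀ n : ℕ, x + 1 + n ≠ 0)
    (hy : ∀ n : ℕ, y + 1 + n ≠ 0) (N : ℕ) :
    ∑ p ∈ antidiagonal N, 1 / (pochhammerNat (x + 1) p.1 * p.1.factorial) *
        (1 / (pochhammerNat (y + 1) p.2 * p.2.factorial)) =
      pochhammerNat (x + y + 1 + N) N /
        (pochhammerNat (x + 1) N * pochhammerNat (y + 1) N * N.factorial) := by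
  rw [pochhammerNat_reflect (x + y + 1 + N),
    show 1 - (x + y + 1 + N) - N = (-y - N) + (-x - N) by ring,
    ← sum_antidiagonal_choose_mul_pochhammerNat, Finset.mul_sum, Finset.sum_div]
  refine Finset.sum_congr rfl fun p hp => ?_
  obtain ⟨n, m⟩ := p
  obtain rfl : n + m = N := by simpa using hp
  have e1 : pochhammerNat (x + 1) (n + m) =
      pochhammerNat (x + 1) n * ((-1) ^ m * pochhammerNat (-x - (n + m : ℕ)) m) := by
    rw [pochhammerNat_add, pochhammerNat_reflect _ m]
    congr 3; push_cast; ring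
  have e2 : pochhammerNat (y + 1) (n + m) =
      pochhammerNat (y + 1) m * ((-1) ^ n * pochhammerNat (-y - (n + m : ℕ)) n) := by
    rw [add_comm n m, pochhammerNat_add, pochhammerNat_reflect _ n]
    congr 3; push_cast; ring
  have h1 := pochhammerNat_ne_zero hx (n + m)
  have h2 := pochhammerNat_ne_zero hy (n + m)
  have h3 := pochhammerNat_ne_zero hx n
  have h4 := pochhammerNat_ne_zero hy m
  have hc : ((n + m).choose n : ℂ) * n.factorial * m.factorial = (n + m).factorial := by
    exact_mod_cast
      (Nat.choose_symm_add (a := n) (b := m)) ▸ Nat.add_choose_mul_factorial_mul_factorial n m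
  have f1 : (n.factorial : ℂ) ≠ 0 := by exact_mod_cast n.factorial_ne_zero
  have f2 : (m.factorial : ℂ) ≠ 0 := by exact_mod_cast m.factorial_ne_zero
  have f3 : ((n + m).factorial : ℂ) ≠ 0 := by exact_mod_cast (n + m).factorial_ne_zero
  dsimp only
  rw [div_mul_div_comm, div_eq_div_iff (by positivity) (by positivity), e1, e2, ← hc, pow_add]
  ring

/-- Up to normalization, the coefficient of the `L`-th orthogonal polynomial for the beta weight
`t ^ (a - 1) * (1 - t) ^ (b - a - 1)` on `[0, 1]` in the expansion of `t ^ n`. -/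
noncomputable def betaCoeff (a b : ℂ) (n L : ℕ) : ℂ :=
  n.descFactorial L * pochhammerNat a n / pochhammerNat b (n + L)

/-- The squared norm of the `L`-th orthogonal polynomial, in the normalization of `betaCoeff`. -/
noncomputable def betaWeight (a b : ℂ) (L : ℕ) : ℂ :=
  pochhammerNat (b - 1) L * pochhammerNat (b - a) L * (b - 1 + 2 * L) /
    ((b - 1) * L.factorial * pochhammerNat a L)

/-- The upper off-diagonal recurrence coefficient. -/
noncomputable def betaUpper (a b : ℂ) (L : ℕ) : ℂ :=
  (b + L - 1) * (b + L - a) / ((b + 2 * L - 1) * (b + 2 * L))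

/-- The lower off-diagonal recurrence coefficient. -/
noncomputable def betaLower (a b : ℂ) (L : ℕ) : ℂ :=
  (L + 1) * (a + L) / ((b + 2 * L) * (b + 2 * L + 1))

lemma cast_descFactorial_succ (n L : ℕ) :
    (n.descFactorial (L + 1) : ℂ) = (n - L) * n.descFactorial L := by
  rw [Nat.descFactorial_succ]
  rcases le_total L n with h | h
  · push_cast [h]; rfl
  · rcases h.eq_or_lt with rfl | h
    · simp
    · simp [Nat.descFactorial_of_lt h]

lemma add_natCast_ne_zero_of_sub_one {b : ℂ} (hb : ∀ n : ℕ, b - 1 + n ≠ 0) (n : ℕ) :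
    b + n ≠ 0 := by
  have := hb (n + 1)
  push_cast at this
  rwa [show b - 1 + ((n : ℂ) + 1) = b + n by ring] at this

lemma betaCoeff_succ_zero (a : ℂ) {b : ℂ} (hb : ∀ n : ℕ, b - 1 + n ≠ 0) (n : ℕ) :
    betaCoeff a b (n + 1) 0 =
      (1 - betaUpper a b 0) * betaCoeff a b n 0 + betaUpper a b 0 * betaCoeff a b n 1 := by
  have hb' := add_natCast_ne_zero_of_sub_one hb
  have h0 : b - 1 ≠ 0 := by simpa using hb 0
  have h1 : b ≠ 0 := by simpa using hb' 0
  have h2 := hb' n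
  have h3 := pochhammerNat_ne_zero hb' n
  simp only [betaCoeff, betaUpper, cast_descFactorial_succ, Nat.descFactorial_zero, add_zero,
    pochhammerNat_succ]
  push_cast
  simp only [mul_zero, add_zero, sub_zero]
  field_simp
  ring

lemma betaCoeff_succ_succ (a : ℂ) {b : ℂ} (hb : ∀ n : ℕ, b - 1 + n ≠ 0) (n L : ℕ) :
    betaCoeff a b (n + 1) (L + 1) =
      betaLower a b L * betaCoeff a b n L +
        (1 - betaLower a b L - betaUpper a b (L + 1)) * betaCoeff a b n (L + 1) +
        betaUpper a b (L + 1) * betaCoeff a b n (L + 2) := by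
  have hb' := add_natCast_ne_zero_of_sub_one hb
  have h1 : b + 2 * L ≠ 0 := by simpa using hb' (2 * L)
  have h2 : b + 2 * L + 1 ≠ 0 := by simpa [add_assoc] using hb' (2 * L + 1)
  have h2' : b + 2 * L + 2 ≠ 0 := by simpa [add_assoc] using hb' (2 * L + 2)
  have h3 := pochhammerNat_ne_zero hb' (n + L)
  have h4 : b + n + L ≠ 0 := by simpa [add_assoc] using hb' (n + L)
  have h5 : b + n + L + 1 ≠ 0 := by simpa [add_assoc] using hb' (n + L + 1)
  simp only [betaCoeff, betaUpper, betaLower, Nat.succ_descFactorial_succ, Nat.cast_mul,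
    cast_descFactorial_succ, show n + 1 + (L + 1) = n + L + 1 + 1 by ring,
    show n + (L + 1) = n + L + 1 by ring, show n + (L + 2) = n + L + 1 + 1 by ring,
    pochhammerNat_succ]
  push_cast
  simp only [← add_assoc]
  rw [show b + 2 * ((L : ℂ) + 1) - 1 = b + 2 * L + 1 by ring,
    show b + 2 * ((L : ℂ) + 1) = b + 2 * L + 2 by ring]
  generalize pochhammerNat b (n + L) = Q at *
  generalize (n.descFactorial L : ℂ) = D
  generalize (n : ℂ) = N at *
  generalize (L : ℂ) = M at *
  obtain ⟨Y, rfl⟩ : ∃ Y, N = Y - b - M := ⟨b + N + M, by ring⟩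
  obtain ⟨X, rfl⟩ : ∃ X, b = X - 2 * M := ⟨b + 2 * M, by ring⟩
  rw [show X - 2 * M + (Y - (X - 2 * M) - M) + M = Y by ring] at *
  rw [show X - 2 * M + 2 * M = X by ring] at *
  field_simp
  ring

lemma betaWeight_succ_mul_betaLower {a b : ℂ} (ha : ∀ n : ℕ, a + n ≠ 0)
    (hb : ∀ n : ℕ, b - 1 + n ≠ 0) (L : ℕ) :
    betaWeight a b (L + 1) * betaLower a b L = betaWeight a b L * betaUpper a b L := by
  have hb' := add_natCast_ne_zero_of_sub_one hb
  have h0 : b - 1 ≠ 0 := by simpa using hb 0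
  have h1 : b + 2 * L ≠ 0 := by simpa using hb' (2 * L)
  have h2 : b + 2 * L + 1 ≠ 0 := by simpa [add_assoc] using hb' (2 * L + 1)
  have h3 : b + 2 * L - 1 ≠ 0 := by
    have := hb (2 * L)
    push_cast at this
    rwa [sub_add_eq_add_sub] at this
  have h4 := pochhammerNat_ne_zero ha L
  have h5 := ha L
  have h6 : (L.factorial : ℂ) ≠ 0 := by exact_mod_cast L.factorial_ne_zero
  have h7 : (L : ℂ) + 1 ≠ 0 := by exact_mod_cast L.succ_ne_zero
  simp only [betaWeight, betaLower, betaUpper, pochhammerNat_succ, Nat.factorial_succ]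
  push_cast
  rw [show b - 1 + 2 * ((L : ℂ) + 1) = b + 2 * L + 1 by ring,
    show b - 1 + 2 * (L : ℂ) = b + 2 * L - 1 by ring]
  generalize b + 2 * (L : ℂ) = X at *
  field_simp
  ring

lemma betaCoeff_of_lt (a b : ℂ) {n L : ℕ} (h : n < L) : betaCoeff a b n L = 0 := by
  simp [betaCoeff, Nat.descFactorial_of_lt h]

lemma sum_betaWeight_sub {a b : ℂ} (ha : ∀ n : ℕ, a + n ≠ 0) (hb : ∀ n : ℕ, b - 1 + n ≠ 0)
    (n m K : ℕ) :
    ∑ L ∈ range (K + 1), (betaWeight a b L * betaCoeff a b (n + 1) L * betaCoeff a b m L -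
        betaWeight a b L * betaCoeff a b n L * betaCoeff a b (m + 1) L) =
      betaWeight a b K * betaUpper a b K *
        (betaCoeff a b n (K + 1) * betaCoeff a b m K -
          betaCoeff a b n K * betaCoeff a b m (K + 1)) := by
  induction K with
  | zero =>
    simp only [zero_add, sum_range_one, betaCoeff_succ_zero a hb]
    ring
  | succ K ih =>
    rw [sum_range_succ, ih, ← betaWeight_succ_mul_betaLower ha hb]
    simp only [betaCoeff_succ_succ a hb]
    ring

/-- Parseval's identity for the monomials `t ^ n` and `t ^ m` under the beta weight. -/
lemma sum_betaWeight_mul_betaCoeff {a b : ℂ} (ha : ∀ n : ℕ, a + n ≠ 0)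
    (hb : ∀ n : ℕ, b - 1 + n ≠ 0) (n m K : ℕ) (hK : n + m ≤ K) :
    ∑ L ∈ range (K + 1), betaWeight a b L * betaCoeff a b n L * betaCoeff a b m L =
      pochhammerNat a (n + m) / pochhammerNat b (n + m) := by
  induction n generalizing m with
  | zero =>
    have h0 : b - 1 ≠ 0 := by simpa using hb 0
    rw [sum_range_succ']
    simp [betaCoeff, betaWeight, pochhammerNat_zero, h0]
  | succ n ih =>
    rw [show n + 1 + m = n + (m + 1) by ring, ← ih (m + 1) (by omega), ← sub_eq_zero,
      ← sum_sub_distrib, sum_betaWeight_sub ha hb, betaCoeff_of_lt a b (by omega : n < K + 1),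
      betaCoeff_of_lt a b (by omega : m < K + 1)]
    ring

lemma exists_inv_norm_add_natCast_le {c : ℂ} (hc : ∀ n : ℕ, c + n ≠ 0) :
    ∃ R : ℝ, 0 ≤ R ∧ ∀ n : ℕ, ‖c + n‖⁻¹ ≤ R / (n + 1) := by
  obtain ⟨M, hM⟩ := exists_nat_ge (‖c‖ + 1)
  set D : ℝ := 1 + ∑ i ∈ range M, ‖c + i‖⁻¹ with hD
  have hS : 0 ≤ ∑ i ∈ range M, ‖c + i‖⁻¹ := sum_nonneg fun i _ => by positivity
  have hle : ∀ n : ℕ, ‖c + n‖⁻¹ ≤ D := by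
    intro n
    rcases lt_or_ge n M with h | h
    · have := single_le_sum (f := fun i : ℕ => ‖c + i‖⁻¹) (fun i _ => by positivity)
        (mem_range.2 h)
      linarith
    · have h1 : (n : ℝ) - ‖c‖ ≤ ‖c + n‖ := by
        have := norm_sub_le (c + n) c
        rw [add_sub_cancel_left, Complex.norm_natCast] at this
        linarith
      have h2 : (M : ℝ) ≤ n := by exact_mod_cast h
      have : ‖c + n‖⁻¹ ≤ 1 := inv_le_one_of_one_le₀ (by linarith)
      linarith
  refine ⟨1 + (‖c‖ + 1) * D, by positivity, fun n => ?_⟩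
  have hpos : 0 < ‖c + n‖ := norm_pos_iff.2 (hc n)
  rw [le_div_iff₀ (by positivity)]
  have h1 : (n : ℝ) ≤ ‖c + n‖ + ‖c‖ := by
    have := norm_sub_le (c + n) c
    rwa [add_sub_cancel_left, Complex.norm_natCast] at this
  calc ‖c + n‖⁻¹ * (n + 1) ≤ ‖c + n‖⁻¹ * (‖c + n‖ + (‖c‖ + 1)) := by gcongr ‖c + n‖⁻¹ * ?_; linarith
    _ = 1 + (‖c‖ + 1) * ‖c + n‖⁻¹ := by field_simp
    _ ≤ _ := by gcongr; exact hle n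

lemma exists_inv_norm_pochhammerNat_le {c : ℂ} (hc : ∀ n : ℕ, c + n ≠ 0) :
    ∃ R : ℝ, 0 ≤ R ∧ ∀ n : ℕ, ‖pochhammerNat c n‖⁻¹ ≤ R ^ n / n.factorial := by
  obtain ⟨R, hR, h⟩ := exists_inv_norm_add_natCast_le hc
  refine ⟨R, hR, fun n => ?_⟩
  induction n with
  | zero => simp [pochhammerNat_zero]
  | succ n ih =>
    rw [pochhammerNat_succ, norm_mul, mul_inv, pow_succ, Nat.factorial_succ, Nat.cast_mul,
      mul_comm ((n + 1 : ℕ) : ℝ), mul_div_mul_comm, Nat.cast_succ]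
    exact mul_le_mul ih (h n) (by positivity) (by positivity)

lemma norm_pochhammerNat_le (c : ℂ) (n : ℕ) :
    ‖pochhammerNat c n‖ ≤ (1 + ‖c‖) ^ n * n.factorial := by
  induction n with
  | zero => simp [pochhammerNat_zero]
  | succ n ih =>
    have h : ‖c + n‖ ≤ (1 + ‖c‖) * (n + 1) := by
      have := norm_add_le c n
      rw [Complex.norm_natCast] at this
      nlinarith [norm_nonneg c, (n.cast_nonneg : (0 : ℝ) ≤ n), mul_nonneg (norm_nonneg c)
        (n.cast_nonneg : (0 : ℝ) ≤ n)]
    rw [pochhammerNat_succ, norm_mul, pow_succ, Nat.factorial_succ, Nat.cast_mul, Nat.cast_succ]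
    calc _ ≤ (1 + ‖c‖) ^ n * n.factorial * ((1 + ‖c‖) * (n + 1)) := by gcongr
      _ = _ := by ring

lemma exists_norm_betaWeight_le {a : ℂ} (b : ℂ) (ha : ∀ n : ℕ, a + n ≠ 0) :
    ∃ K M : ℝ, 0 ≤ K ∧ 0 ≤ M ∧ ∀ L : ℕ, ‖betaWeight a b L‖ ≤ K * M ^ L := by
  obtain ⟨R, hR, h⟩ := exists_inv_norm_pochhammerNat_le ha
  refine ⟨(1 + ‖b - 1‖) * ‖b - 1‖⁻¹, (1 + ‖b - 1‖) * (1 + ‖b - a‖) * 4 * R, by positivity,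
    by positivity, fun L => ?_⟩
  have hlin : ‖b - 1 + 2 * L‖ ≤ (1 + ‖b - 1‖) * 4 ^ L := by
    have h1 := norm_add_le (b - 1) (2 * L)
    rw [norm_mul, Complex.norm_natCast, Complex.norm_ofNat] at h1
    have h2 : ((2 * L + 1 : ℕ) : ℝ) ≤ (2 ^ (2 * L) : ℕ) := by
      exact_mod_cast (Nat.lt_two_pow_self (n := 2 * L))
    rw [pow_mul] at h2
    push_cast at h2
    have h3 : (0 : ℝ) ≤ L := L.cast_nonneg
    nlinarith [norm_nonneg (b - 1)]
  have hf : (0 : ℝ) < L.factorial := by exact_mod_cast L.factorial_pos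
  rw [betaWeight, norm_div, div_eq_mul_inv]
  simp only [norm_mul, mul_inv, Complex.norm_natCast]
  calc _ ≤ ((1 + ‖b - 1‖) ^ L * L.factorial) * ((1 + ‖b - a‖) ^ L * L.factorial) *
        ((1 + ‖b - 1‖) * 4 ^ L) * (‖b - 1‖⁻¹ * (L.factorial : ℝ)⁻¹ * (R ^ L / L.factorial)) := by
        gcongr
        · exact norm_pochhammerNat_le _ _
        · exact norm_pochhammerNat_le _ _
        · exact h L
    _ = _ := by
        simp only [mul_pow]
        field_simp

/-- The terms of the expansion coefficient of the `0F1` function with parameter `x + 1` along the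
`L`-th orthogonal polynomial. -/
noncomputable def besselCoeffTerm (a b x y : ℂ) (L n : ℕ) : ℂ :=
  betaCoeff a b n L * (1 / (pochhammerNat (x + 1) n * n.factorial)) * y ^ n

lemma exists_norm_besselCoeffTerm_le (a : ℂ) {b x : ℂ} (y : ℂ) (hb : ∀ n : ℕ, b + n ≠ 0)
    (hx : ∀ n : ℕ, x + 1 + n ≠ 0) :
    ∃ P Q : ℝ, 0 ≤ P ∧ 0 ≤ Q ∧ ∀ L n : ℕ,
      ‖besselCoeffTerm a b x y L n‖ ≤ P ^ L / L.factorial * (Q ^ n / n.factorial) := by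
  obtain ⟨R, hR, h⟩ := exists_inv_norm_pochhammerNat_le hb
  obtain ⟨S, hS, h'⟩ := exists_inv_norm_pochhammerNat_le hx
  refine ⟨R, (1 + ‖a‖) * R * S * ‖y‖, hR, by positivity, fun L n => ?_⟩
  have hf : (0 : ℝ) < L.factorial := by exact_mod_cast L.factorial_pos
  have hn : (0 : ℝ) < n.factorial := by exact_mod_cast n.factorial_pos
  have h1 : (n.descFactorial L : ℝ) ≤ n.factorial := by
    rcases le_or_gt L n with hL | hL
    · rw [← Nat.factorial_mul_descFactorial hL]
      push_cast
      exact le_mul_of_one_le_left (by positivity) (by exact_mod_cast Nat.factorial_pos _)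
    · rw [Nat.descFactorial_of_lt hL]; simp
  have h2 : ‖pochhammerNat b (n + L)‖⁻¹ ≤ R ^ (n + L) / (n.factorial * L.factorial) := by
    refine (h _).trans ?_
    gcongr
    exact_mod_cast Nat.le_of_dvd (Nat.factorial_pos _) (Nat.factorial_mul_factorial_dvd_factorial_add n L)
  simp only [besselCoeffTerm, betaCoeff, norm_mul, norm_pow, norm_inv, Complex.norm_natCast,
    div_eq_mul_inv, mul_inv, one_mul]
  calc _ ≤ n.factorial * ((1 + ‖a‖) ^ n * n.factorial) *
        (R ^ (n + L) / (n.factorial * L.factorial)) * (S ^ n / n.factorial * (n.factorial : ℝ)⁻¹) *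
          ‖y‖ ^ n := by
        gcongr
        · exact norm_pochhammerNat_le _ _
        · exact h' n
    _ = _ := by
        simp only [mul_pow, pow_add]
        field_simp

lemma summable_besselCoeffTerm_triple {a b x z : ℂ} (y : ℂ) (ha : ∀ n : ℕ, a + n ≠ 0)
    (hb : ∀ n : ℕ, b + n ≠ 0) (hx : ∀ n : ℕ, x + 1 + n ≠ 0) (hz : ∀ n : ℕ, z + 1 + n ≠ 0) :
    Summable fun p : ℕ × ℕ × ℕ => betaWeight a b p.1 *
      (besselCoeffTerm a b x y p.1 p.2.1 * besselCoeffTerm a b z y p.1 p.2.2) := by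
  obtain ⟨K, M, hK, hM, hw⟩ := exists_norm_betaWeight_le b ha
  obtain ⟨P, Q, hP, hQ, h⟩ := exists_norm_besselCoeffTerm_le a y hb hx
  obtain ⟨P', Q', hP', hQ', h'⟩ := exists_norm_besselCoeffTerm_le a y hb hz
  have hs := (((Real.summable_pow_div_factorial (M * P * P')).mul_left K).mul_of_nonneg
    ((Real.summable_pow_div_factorial Q).mul_of_nonneg (Real.summable_pow_div_factorial Q')
      (fun _ => by positivity) (fun _ => by positivity)) (fun _ => by positivity)
      (fun p => by dsimp; positivity))
  refine Summable.of_norm_bounded hs ?_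
  rintro ⟨L, n, m⟩
  have hf : (1 : ℝ) ≤ L.factorial := by exact_mod_cast L.factorial_pos
  simp only [norm_mul]
  calc _ ≤ K * M ^ L * ((P ^ L / L.factorial * (Q ^ n / n.factorial)) *
        (P' ^ L / 1 * (Q' ^ m / m.factorial))) := by
        gcongr
        · exact hw L
        · exact h L n
        · exact (h' L m).trans (by gcongr)
    _ = _ := by simp only [mul_pow]; ring

lemma summable_besselCoeffTerm (a : ℂ) {b x : ℂ} (y : ℂ) (hb : ∀ n : ℕ, b + n ≠ 0)
    (hx : ∀ n : ℕ, x + 1 + n ≠ 0) (L : ℕ) :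
    Summable fun n => ‖besselCoeffTerm a b x y L n‖ := by
  obtain ⟨P, Q, hP, hQ, h⟩ := exists_norm_besselCoeffTerm_le a y hb hx
  exact Summable.of_nonneg_of_le (fun _ => norm_nonneg _) (h L)
    ((Real.summable_pow_div_factorial Q).mul_left _)

/-- The expansion coefficient along the `L`-th orthogonal polynomial is a `1F2` function. -/
lemma tsum_besselCoeffTerm {a b x : ℂ} (y : ℂ) (hb : ∀ n : ℕ, b + n ≠ 0)
    (hx : ∀ n : ℕ, x + 1 + n ≠ 0) (L : ℕ) :
    ∑' n, besselCoeffTerm a b x y L n =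
      y ^ L * pochhammerNat a L / (pochhammerNat b (2 * L) * pochhammerNat (x + 1) L) *
        hypergeometricPFQ {L + a} {L + x + 1, 2 * L + b} y := by
  rw [← (summable_besselCoeffTerm a y hb hx L).of_norm.sum_add_tsum_nat_add L,
    sum_eq_zero fun n hn => by
      simp [besselCoeffTerm, betaCoeff_of_lt a b (mem_range.1 hn)], zero_add,
    hypergeometricPFQ, ← tsum_mul_left]
  refine tsum_congr fun j => ?_
  have e1 : pochhammerNat b (j + L + L) =
      pochhammerNat b (2 * L) * pochhammerNat (2 * L + b) j := by
    rw [show j + L + L = 2 * L + j by ring, pochhammerNat_add, add_comm b]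
    push_cast; rfl
  have e2 : pochhammerNat (x + 1) (j + L) =
      pochhammerNat (x + 1) L * pochhammerNat (L + x + 1) j := by
    rw [add_comm j, pochhammerNat_add]
    congr 2; ring
  have e3 : pochhammerNat a (j + L) = pochhammerNat a L * pochhammerNat (L + a) j := by
    rw [add_comm j, pochhammerNat_add, add_comm a]
  have e4 : ((j + L).factorial : ℂ) = j.factorial * (j + L).descFactorial L := by
    have := Nat.factorial_mul_descFactorial (Nat.le_add_left L j)
    rw [Nat.add_sub_cancel] at this
    exact_mod_cast this.symm
  have h1 := pochhammerNat_ne_zero hb (j + L + L)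
  have h2 := pochhammerNat_ne_zero hx (j + L)
  have h3 : ((j + L).factorial : ℂ) ≠ 0 := by exact_mod_cast (j + L).factorial_ne_zero
  simp only [Multiset.insert_eq_cons, Multiset.map_cons, Multiset.map_singleton,
    Multiset.prod_cons, Multiset.prod_singleton]
  simp only [← pochhammerNat.eq_1, besselCoeffTerm, betaCoeff]
  rw [e1] at h1 ⊢
  rw [e2] at h2 ⊢
  rw [e4] at h3 ⊢
  rw [e3, pow_add]
  simp only [mul_ne_zero_iff] at h1 h2 h3
  obtain ⟨h11, h12⟩ := h1
  obtain ⟨h21, h22⟩ := h2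
  obtain ⟨h31, h32⟩ := h3
  field_simp

lemma tsum_betaWeight_mul_besselCoeffTerm {a b x z : ℂ} (y : ℂ) (ha : ∀ n : ℕ, a + n ≠ 0)
    (hb : ∀ n : ℕ, b - 1 + n ≠ 0) (n m : ℕ) :
    ∑' L, betaWeight a b L * (besselCoeffTerm a b x y L n * besselCoeffTerm a b z y L m) =
      pochhammerNat a (n + m) / pochhammerNat b (n + m) * y ^ (n + m) *
        (1 / (pochhammerNat (x + 1) n * n.factorial) *
          (1 / (pochhammerNat (z + 1) m * m.factorial))) := by
  rw [tsum_eq_sum (s := range (n + m + 1)), ← sum_betaWeight_mul_betaCoeff ha hb n m _ le_rfl]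
  · rw [sum_mul, sum_mul]
    refine sum_congr rfl fun L _ => ?_
    rw [besselCoeffTerm, besselCoeffTerm, pow_add]
    ring
  · intro L hL
    rw [mem_range] at hL
    simp [besselCoeffTerm, betaCoeff_of_lt a b (by omega : n < L)]

lemma hasSum_tsum_sum_antidiagonal {f : ℕ × ℕ × ℕ → ℂ} (hf : Summable f) :
    HasSum (fun L => ∑' p, f (L, p)) (∑' N, ∑ p ∈ antidiagonal N, ∑' L, f (L, p)) := by
  have h1 : ∑' N, ∑ p ∈ antidiagonal N, ∑' L, f (L, p) = ∑' p, ∑' L, f (L, p) := by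
    have hg : Summable fun p => ∑' L, f (L, p) := hf.prod_symm.prod
    conv_lhs => congr; ext; rw [← Finset.sum_finset_coe, ← tsum_fintype (L := .unconditional _)]
    rw [← HasAntidiagonal.sigmaAntidiagonalEquivProd.tsum_eq (fun p => ∑' L, f (L, p))]
    exact ((HasAntidiagonal.sigmaAntidiagonalEquivProd.summable_iff.2 hg).tsum_sigma'
      (fun n => (hasSum_fintype _).summable)).symm
  have h2 := Summable.tsum_comm (f := fun L p => f (L, p)) hf
  rw [h1, h2]
  exact hf.prod.hasSum

/-- Parseval's identity for the product of two `0F1` functions against the beta weight. -/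
lemma hasSum_betaWeight_mul_hypergeometricPFQ {a b x z : ℂ} (y : ℂ) (ha : ∀ n : ℕ, a + n ≠ 0)
    (hb : ∀ n : ℕ, b - 1 + n ≠ 0) (hx : ∀ n : ℕ, x + 1 + n ≠ 0) (hz : ∀ n : ℕ, z + 1 + n ≠ 0) :
    HasSum (fun L : ℕ => betaWeight a b L *
      (y ^ L * pochhammerNat a L / (pochhammerNat b (2 * L) * pochhammerNat (x + 1) L) *
        hypergeometricPFQ {L + a} {L + x + 1, 2 * L + b} y *
      (y ^ L * pochhammerNat a L / (pochhammerNat b (2 * L) * pochhammerNat (z + 1) L) *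
        hypergeometricPFQ {L + a} {L + z + 1, 2 * L + b} y)))
      (∑' N : ℕ, pochhammerNat a N / pochhammerNat b N * y ^ N *
        (pochhammerNat (x + z + 1 + N) N /
          (pochhammerNat (x + 1) N * pochhammerNat (z + 1) N * N.factorial))) := by
  have hb' := add_natCast_ne_zero_of_sub_one hb
  convert hasSum_tsum_sum_antidiagonal (summable_besselCoeffTerm_triple y ha hb' hx hz) using 1
  · ext L
    dsimp only
    rw [tsum_mul_left, ← tsum_mul_tsum_of_summable_norm (summable_besselCoeffTerm a y hb' hx L)
      (summable_besselCoeffTerm a y hb' hz L), tsum_besselCoeffTerm y hb' hx,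
      tsum_besselCoeffTerm y hb' hz]
  · refine tsum_congr fun N => ?_
    rw [← sum_antidiagonal_inv_pochhammerNat hx hz, mul_sum]
    refine sum_congr rfl fun p hp => ?_
    have hp : p.1 + p.2 = N := by simpa using hp
    dsimp only
    rw [tsum_betaWeight_mul_besselCoeffTerm y ha hb, hp]

lemma two_cpow_mul_two_cpow (s : ℂ) (L : ℕ) :
    (2 : ℂ) ^ (2 * s - 3) * (2 : ℂ) ^ (4 * (L : ℂ) - 2 * s + 2) = 16 ^ L / 2 := by
  rw [← Complex.cpow_add _ _ two_ne_zero,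
    show 2 * s - 3 + (4 * (L : ℂ) - 2 * s + 2) = ((4 * L : ℕ) : ℂ) - 1 by push_cast; ring,
    Complex.cpow_sub _ _ two_ne_zero, Complex.cpow_one, Complex.cpow_natCast, pow_mul]
  norm_num

lemma half_add_natCast_ne_zero (n : ℕ) : (1 / 2 : ℂ) + n ≠ 0 := fun h => by
  have := congrArg Complex.re h
  simp at this
  linarith [(n.cast_nonneg : (0 : ℝ) ≤ n)]

lemma pochhammerGamma_half {x : ℂ} (hx : ∀ n : ℕ, x + 1 + n ≠ 0) (L : ℕ) :
    pochhammerGamma ((L : ℂ) + 1 / 2) (x + 1 / 2) =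
      pochhammerNat (x + 1) L * Complex.Gamma (x + 1) /
        (pochhammerNat (1 / 2) L * Complex.Gamma (1 / 2)) := by
  rw [pochhammerGamma, ← Gamma_add_natCast hx, ← Gamma_add_natCast half_add_natCast_ne_zero]
  congr 2 <;> ring

lemma hypergeometricPFQ_two_three_eq_tsum {k μ ν : ℂ} (hb : ∀ n : ℕ, μ + ν + 1 + n ≠ 0) :
    hypergeometricPFQ {1 / 2, μ / 2 + ν / 2 + 1} {μ + 1, ν + 1, μ + ν + 1} (-k ^ 2) =
      ∑' N : ℕ, pochhammerNat (1 / 2) N / pochhammerNat (μ / 2 + ν / 2 + 1 / 2) N *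
        (-k ^ 2 / 4) ^ N * (pochhammerNat (μ + ν + 1 + N) N /
          (pochhammerNat (μ + 1) N * pochhammerNat (ν + 1) N * N.factorial)) := by
  refine tsum_congr fun N => ?_
  have h1 : pochhammerNat (μ + ν + 1) N * pochhammerNat (μ + ν + 1 + N) N =
      4 ^ N * pochhammerNat (μ / 2 + ν / 2 + 1 / 2) N * pochhammerNat (μ / 2 + ν / 2 + 1) N := by
    rw [← pochhammerNat_add, ← two_mul,
      show μ + ν + 1 = 2 * (μ / 2 + ν / 2 + 1 / 2) by ring, pochhammerNat_two_mul]
    congr 2; ring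
  have h2 := pochhammerNat_ne_zero hb N
  have h3 := pochhammerNat_ne_zero (fun n => by
    have := hb (2 * n)
    contrapose! this
    push_cast
    linear_combination 2 * this : ∀ n : ℕ, μ / 2 + ν / 2 + 1 / 2 + n ≠ 0) N
  simp only [Multiset.insert_eq_cons, Multiset.map_cons, Multiset.map_singleton,
    Multiset.prod_cons, Multiset.prod_singleton, ← pochhammerNat.eq_1]
  have h4 : pochhammerNat (μ + ν + 1 + N) N = 4 ^ N * pochhammerNat (μ / 2 + ν / 2 + 1 / 2) N *
      pochhammerNat (μ / 2 + ν / 2 + 1) N / pochhammerNat (μ + ν + 1) N := by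
    rw [eq_div_iff h2, mul_comm, h1]
  rw [h4, div_pow]
  generalize pochhammerNat (μ / 2 + ν / 2 + 1 / 2) N = B at *
  field_simp

lemma pairProductTerm_eq {k μ ν : ℂ} (hμ : ∀ n : ℕ, μ + 1 + n ≠ 0) (hν : ∀ n : ℕ, ν + 1 + n ≠ 0)
    (hs : ∀ n : ℕ, μ + ν - 1 + n ≠ 0) (L : ℕ) :
    (2 : ℂ) ^ (2 * (μ + ν) - 3) * (μ + ν - 1) * Complex.Gamma (μ + 1) * Complex.Gamma (ν + 1) /
        ((Real.pi : ℂ) * Complex.Gamma (μ + ν - 1)) * pairProductTerm k μ ν L =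
      betaWeight (1 / 2) (μ / 2 + ν / 2 + 1 / 2) L *
      ((-k ^ 2 / 4) ^ L * pochhammerNat (1 / 2) L /
          (pochhammerNat (μ / 2 + ν / 2 + 1 / 2) (2 * L) * pochhammerNat (μ + 1) L) *
        hypergeometricPFQ {(L : ℂ) + 1 / 2}
          {(L : ℂ) + μ + 1, 2 * (L : ℂ) + (μ / 2 + ν / 2 + 1 / 2)} (-k ^ 2 / 4) *
      ((-k ^ 2 / 4) ^ L * pochhammerNat (1 / 2) L /
          (pochhammerNat (μ / 2 + ν / 2 + 1 / 2) (2 * L) * pochhammerNat (ν + 1) L) *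
        hypergeometricPFQ {(L : ℂ) + 1 / 2}
          {(L : ℂ) + ν + 1, 2 * (L : ℂ) + (μ / 2 + ν / 2 + 1 / 2)} (-k ^ 2 / 4))) := by
  rw [pairProductTerm, Multiset.pair_comm (2 * (L : ℂ) + μ / 2 + ν / 2 + 1 / 2),
    show 2 * (L : ℂ) + μ / 2 + ν / 2 + 1 / 2 = 2 * (L : ℂ) + (μ / 2 + ν / 2 + 1 / 2) by ring,
    show 4 * (L : ℂ) - 2 * μ - 2 * ν + 2 = 4 * (L : ℂ) - 2 * (μ + ν) + 2 by ring,
    pochhammerGamma_half hμ, pochhammerGamma_half hν, factorial_two_mul_eq]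
  generalize hypergeometricPFQ {(L : ℂ) + 1 / 2}
    {(L : ℂ) + μ + 1, 2 * (L : ℂ) + (μ / 2 + ν / 2 + 1 / 2)} (-k ^ 2 / 4) = F₁
  generalize hypergeometricPFQ {(L : ℂ) + 1 / 2}
    {(L : ℂ) + ν + 1, 2 * (L : ℂ) + (μ / 2 + ν / 2 + 1 / 2)} (-k ^ 2 / 4) = F₂
  obtain ⟨c, hc⟩ : ∃ c, c = μ / 2 + ν / 2 - 1 / 2 := ⟨_, rfl⟩
  have e1 : μ + ν - 1 = 2 * c := by rw [hc]; ring
  have e2 : μ / 2 + ν / 2 = c + 1 / 2 := by rw [hc]; ring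
  have e3 : 2 * (L : ℂ) + μ / 2 + ν / 2 - 1 / 2 = c + 2 * L := by rw [hc]; ring
  have e4 : 2 * (L : ℂ) + μ + ν - 1 = 2 * c + (2 * L : ℕ) := by rw [hc]; push_cast; ring
  rw [e1] at hs
  have hc2 : ∀ n : ℕ, c + n ≠ 0 := fun n h => hs (2 * n) (by
    push_cast; linear_combination 2 * h)
  have hc3 : ∀ n : ℕ, c + 1 / 2 + n ≠ 0 := fun n h => hs (2 * n + 1) (by
    push_cast; linear_combination 2 * h)
  have hp := two_cpow_mul_two_cpow (μ + ν) L
  rw [e3, e4, e1, e2, Gamma_add_natCast hs]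
  have hX : pochhammerNat (2 * c) (2 * L) * pochhammerNat (2 * c + (2 * L : ℕ)) (2 * L) =
      16 ^ L * pochhammerNat c (2 * L) * pochhammerNat (c + 1 / 2) (2 * L) := by
    rw [← pochhammerNat_add, ← two_mul, pochhammerNat_two_mul, pow_mul]; norm_num
  have hY : pochhammerNat (2 * c) (2 * L) =
      4 ^ L * pochhammerNat c L * pochhammerNat (c + 1 / 2) L := pochhammerNat_two_mul c L
  have hE : pochhammerNat c (2 * L) * (c + 2 * L) =
      c * pochhammerNat (c + 1 / 2 + 1 / 2) (2 * L) := by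
    have := pochhammerNat_succ c (2 * L)
    rw [add_comm (2 * L) 1, pochhammerNat_add, pochhammerNat_succ, pochhammerNat_zero] at this
    push_cast at this
    rw [← this, add_assoc c, add_halves]
    ring
  have hpi : Complex.Gamma (1 / 2) ^ 2 = Real.pi := by
    rw [Complex.Gamma_one_half_eq, ← Complex.cpow_nat_mul]; norm_num
  have hpi0 : (Real.pi : ℂ) ≠ 0 := by exact_mod_cast Real.pi_ne_zero
  have hG0 : Complex.Gamma (1 / 2) ≠ 0 := Complex.Gamma_ne_zero fun m h =>
    half_add_natCast_ne_zero m (by rw [h]; ring)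
  have hGμ : Complex.Gamma (μ + 1) ≠ 0 := Complex.Gamma_ne_zero fun m h =>
    hμ m (by rw [h]; ring)
  have hGν : Complex.Gamma (ν + 1) ≠ 0 := Complex.Gamma_ne_zero fun m h =>
    hν m (by rw [h]; ring)
  have hGc : Complex.Gamma (2 * c) ≠ 0 := Complex.Gamma_ne_zero fun m h =>
    hs m (by rw [h]; ring)
  have n1 := pochhammerNat_ne_zero hμ L
  have n2 := pochhammerNat_ne_zero hν L
  have n3 := pochhammerNat_ne_zero half_add_natCast_ne_zero L
  have n4 := pochhammerNat_ne_zero hc2 (2 * L)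
  have n5 := pochhammerNat_ne_zero hc3 (2 * L)
  have n6 : (L.factorial : ℂ) ≠ 0 := by exact_mod_cast L.factorial_ne_zero
  have n7 : c ≠ 0 := by simpa using hc2 0
  have n8 : c + 2 * L ≠ 0 := by simpa using hc2 (2 * L)
  have n9 := pochhammerNat_ne_zero hc2 L
  have n10 := pochhammerNat_ne_zero hc3 L
  have n11 := pochhammerNat_ne_zero hs (2 * L)
  have hX' : pochhammerNat (2 * c + (2 * L : ℕ)) (2 * L) =
      16 ^ L * pochhammerNat c (2 * L) * pochhammerNat (c + 1 / 2) (2 * L) /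
        pochhammerNat (2 * c) (2 * L) := by rw [eq_div_iff n11, mul_comm, hX]
  have hB : pochhammerNat (c + 1 / 2 + 1 / 2) (2 * L) =
      pochhammerNat c (2 * L) * (c + 2 * L) / c := by rw [eq_div_iff n7, hE, mul_comm]
  have hP : (2 : ℂ) ^ (4 * (L : ℂ) - 2 * (μ + ν) + 2) =
      16 ^ L / 2 / (2 : ℂ) ^ (2 * (μ + ν) - 3) := by
    rw [← hp, mul_div_cancel_left₀ _ (by simp [Complex.cpow_eq_zero_iff])]
  have hP0 : (2 : ℂ) ^ (2 * (μ + ν) - 3) ≠ 0 := by simp [Complex.cpow_eq_zero_iff]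
  have hk : (-k ^ 2 / 4 : ℂ) ^ L * (-k ^ 2 / 4) ^ L = k ^ (4 * L) / 16 ^ L := by
    rw [← mul_pow, show -k ^ 2 / 4 * (-k ^ 2 / 4) = k ^ 4 / 16 by ring, div_pow, ← pow_mul]
  rw [betaWeight, hX', hB, hP, ← hpi, hY, show c + 1 / 2 + 1 / 2 - 1 = c by ring,
    show c + 1 / 2 + 1 / 2 - 1 / 2 = c + 1 / 2 by ring, pow_mul (-1 : ℂ) 2 L, neg_one_sq, one_pow]
  generalize (2 : ℂ) ^ (2 * (μ + ν) - 3) = T at *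
  generalize c + 2 * (L : ℂ) = Z at *
  generalize pochhammerNat (c + 1 / 2) (2 * L) = S at *
  calc _ = (c * pochhammerNat c L * pochhammerNat (c + 1 / 2) L * pochhammerNat (1 / 2) L /
        (L.factorial * Z * pochhammerNat c (2 * L) ^ 2 * pochhammerNat (μ + 1) L *
          pochhammerNat (ν + 1) L)) * F₁ * F₂ * (k ^ (4 * L) / 16 ^ L) := by
        field_simp
    _ = _ := by
        rw [← hk]
        field_simp

theorem mainTheorem9 (k μ ν : ℂ)
    (hμ : ∀ n : ℕ, μ ≠ -((n : ℂ) + 1))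
    (hν : ∀ n : ℕ, ν ≠ -((n : ℂ) + 1))
    (hμν : ∀ n : ℕ, μ + ν ≠ 1 - (n : ℂ)) :
    Summable (fun L : ℕ => pairProductTerm k μ ν L) ∧
    hypergeometricPFQ {1 / 2, μ / 2 + ν / 2 + 1} {μ + 1, ν + 1, μ + ν + 1} (-k ^ 2) =
      (2 : ℂ) ^ (2 * (μ + ν) - 3) * (μ + ν - 1) * Complex.Gamma (μ + 1) * Complex.Gamma (ν + 1) /
          ((Real.pi : ℂ) * Complex.Gamma (μ + ν - 1)) *
        ∑' L : ℕ, pairProductTerm k μ ν L := by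
  have hμ' : ∀ n : ℕ, μ + 1 + n ≠ 0 := fun n h => hμ n (by linear_combination h)
  have hν' : ∀ n : ℕ, ν + 1 + n ≠ 0 := fun n h => hν n (by linear_combination h)
  have hs : ∀ n : ℕ, μ + ν - 1 + n ≠ 0 := fun n h => hμν n (by linear_combination h)
  have hs' : ∀ n : ℕ, μ + ν + 1 + n ≠ 0 := fun n h => hs (n + 2) (by
    push_cast; linear_combination h)
  have hb : ∀ n : ℕ, μ / 2 + ν / 2 + 1 / 2 - 1 + n ≠ 0 := fun n h => hs (2 * n) (by
    push_cast; linear_combination 2 * h)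
  have hsum := hasSum_betaWeight_mul_hypergeometricPFQ (-k ^ 2 / 4) half_add_natCast_ne_zero hb
    hμ' hν'
  rw [← hypergeometricPFQ_two_three_eq_tsum hs'] at hsum
  simp only [← pairProductTerm_eq hμ' hν' hs] at hsum
  have hGμ : Complex.Gamma (μ + 1) ≠ 0 := Complex.Gamma_ne_zero fun m h =>
    hμ' m (by rw [h]; ring)
  have hGν : Complex.Gamma (ν + 1) ≠ 0 := Complex.Gamma_ne_zero fun m h =>
    hν' m (by rw [h]; ring)
  have hGs : Complex.Gamma (μ + ν - 1) ≠ 0 := Complex.Gamma_ne_zero fun m h =>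
    hs m (by rw [h]; ring)
  have hpi0 : (Real.pi : ℂ) ≠ 0 := by exact_mod_cast Real.pi_ne_zero
  have hs0 : μ + ν - 1 ≠ 0 := by simpa using hs 0
  have hP0 : (2 : ℂ) ^ (2 * (μ + ν) - 3) ≠ 0 := by simp [Complex.cpow_eq_zero_iff]
  refine ⟨(summable_mul_left_iff ?_).1 hsum.summable, ?_⟩
  · exact div_ne_zero (mul_ne_zero (mul_ne_zero (mul_ne_zero hP0 hs0) hGμ) hGν)
      (mul_ne_zero hpi0 hGs)
  · rw [← hsum.tsum_eq, tsum_mul_left]
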